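/- Let $\kappa$ be a weakly compact cardinal, that is, a regular strong limit cardinal with the tree property: every tree of height $\kappa$ all of whose levels have fewer than $\kappa$ elements has a branch of length $\kappa$ (so $\kappa$ is inaccessible with the tree property, or $\kappa=\aleph_0$, which is allowed). A lattice $L$ is *$\kappa$-complete* if every subset with fewer than $\kappa$ elements has a meet and a join. A *bar* over the tree $\kappa^{\kappa}$ is a set $U$ of nodes $f\in\kappa^{\beta}$, $\beta<\kappa$, which is closed under extension of nodes and such that every $x\in\kappa^{\kappa}$ has a restriction in $U$. Let $S$ be a (possibly empty) set of subsets of $L$. A $\kappa$-complete lattice $L$, with the joins of the sets in $S$ (where they exist) as additional admissible joins, is *$\kappa$-distributive* if for every family $\{a_f : f\in\kappa^{\beta},\ \beta<\kappa\}$ of elements of $L$ such that - for all $f\in\kappa^\beta$, $\beta<\kappa$, the set $\{a_g : g\in\kappa^{\beta+1},\ g|_\beta=f\}$ has fewer than $\kappa$ elements or belongs to $S$, it has a join, and $a_f\le\bigvee_{g\in\kappa^{\beta+1},\,g|_\beta=f}a_g$; - $a_f=\bigwedge_{\alpha<\beta}a_{f|_\alpha}$ for all limit ordinals $\beta<\kappa$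 and $f\in\kappa^\beta$; and for every bar $U$ over $\kappa^\kappa$ with set $B$ of minimal elements, the join $\bigvee_{f\in B}\bigwedge_{\beta\le\delta_f}a_{f|_\beta}$ exists and equals $a_\emptyset$, where $\delta_f$ is the level of $f$ (that is, $f\in\kappa^{\delta_f}$). A filter (ideal) of $L$ is *$\kappa$-complete* if it is closed under meets (joins) of fewer than $\kappa$ many elements; a filter is *$\kappa$-prime* if whenever it contains the join of fewer than $\kappa$ many elements, it contains one of them. Filters and ideals are nonempty. **Statement.** Let $L$ be a nontrivial lattice of cardinality at most $\kappa$ which is $\kappa$-complete and $\kappa$-distributive (with respect to some set $S$ as above). Let $F$ be a $\kappa$-complete filter and $I$ a $\kappa$-complete ideal of $L$ with $F\cap I=\emptyset$. Then there is a $\kappa$-complete, $\kappa$-prime filter $P$ of $L$ with $F\subseteq P$ and $P\cap I=\emptyset$. -/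

import Mathlib

universe u

open Cardinal Order

/-! ### Weakly compact cardinals -/

/-- A partial order is a (set-theoretic) tree if the set of predecessors of each of its elements
is well ordered. -/
def IsSetTree (T : Type u) [PartialOrder T] : Prop :=
  ∀ x : T, IsWellOrder {y : T // y < x} (fun y z => y < z)

/-- The height of a node of a tree: the order type of the set of its predecessors. -/
noncomputable def IsSetTree.height {T : Type u} [PartialOrder T] (hT : IsSetTree T) (x : T) :
    Ordinal.{u} :=
  @Ordinal.type {y : T // y < x} (fun y z => y < z) (hT x)

/-- The tree property of `κ`: every tree of height `κ` all of whose levels have fewer than `κ`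
elements has a branch of length `κ`, that is, a chain that meets every level below `κ`. -/
def HasTreeProperty (κ : Cardinal.{u}) : Prop :=
  ∀ (T : Type u) [PartialOrder T] (hT : IsSetTree T),
    (∀ x : T, hT.height x < κ.ord) →
    (∀ α : Ordinal.{u}, α < κ.ord →
      {x : T | hT.height x = α}.Nonempty ∧ #{x : T | hT.height x = α} < κ) →
    ∃ C : Set T, IsChain (· ≤ ·) C ∧ ∀ α : Ordinal.{u}, α < κ.ord → ∃ x ∈ C, hT.height x = α

/-- A cardinal is weakly compact if it is a regular strong limit cardinal with the tree property.
The uncountable ones are the inaccessible cardinals with the tree property; `ℵ₀` is allowed too. -/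
structure IsWeaklyCompact (κ : Cardinal.{u}) : Prop where
  isRegular : κ.IsRegular
  isStrongLimit : κ.IsStrongLimit
  treeProperty : HasTreeProperty κ

/-! ### The tree `κ^{<κ}` -/

/-- A node of the tree `κ^{<κ}`: a function `f : β → κ` for an ordinal `β < κ`, its level. -/
structure SeqNode (κ : Cardinal.{u}) where
  level : Ordinal.{u}
  level_lt : level < κ.ord
  val : Set.Iio level → Set.Iio κ.ord

namespace SeqNode

variable {κ : Cardinal.{u}}

/-- `f.IsPrefix g` means that `f` is the restriction of `g` to an ordinal `α ≤ g.level`. -/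
def IsPrefix (f g : SeqNode κ) : Prop :=
  ∃ h : f.level ≤ g.level,
    ∀ i : Set.Iio f.level, f.val i = g.val ⟨i.1, lt_of_lt_of_le i.2 h⟩

/-- The immediate successors of `f`: the `g ∈ κ^(β+1)` with `g|β = f`, where `f ∈ κ^β`. -/
def children (f : SeqNode κ) : Set (SeqNode κ) :=
  {g | f.IsPrefix g ∧ g.level = succ f.level}

/-- `f` lies on the branch `x ∈ κ^κ`. -/
def OnBranch (f : SeqNode κ) (x : Set.Iio κ.ord → Set.Iio κ.ord) : Prop :=
  ∀ i : Set.Iio f.level, f.val i = x ⟨i.1, lt_trans i.2 f.level_lt⟩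

/-- A bar over the tree `κ^κ`: an upward closed set of nodes that meets every branch. -/
def IsBar (U : Set (SeqNode κ)) : Prop :=
  (∀ f ∈ U, ∀ g : SeqNode κ, f.IsPrefix g → g ∈ U) ∧
    ∀ x : Set.Iio κ.ord → Set.Iio κ.ord, ∃ f ∈ U, f.OnBranch x

/-- The minimal elements of a set of nodes. -/
def minimals (U : Set (SeqNode κ)) : Set (SeqNode κ) :=
  {f | f ∈ U ∧ ∀ g ∈ U, g.IsPrefix f → g = f}

end SeqNode

/-! ### `κ`-complete and `κ`-distributive lattices -/

/-- `L` is `κ`-complete: meets and joins of fewer than `κ` many elements exist. -/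
def IsKComplete (κ : Cardinal.{u}) (L : Type u) [Lattice L] : Prop :=
  ∀ A : Set L, #A < κ → (∃ m : L, IsGLB A m) ∧ ∃ j : L, IsLUB A j

/-- `κ`-distributivity of a `κ`-complete lattice `L`, considered together with a set `S` of
subsets of `L` whose joins, if they exist, may be used besides the joins of fewer than `κ` many
elements. For each family `a` indexed by the nodes of `κ^{<κ}` such that
* `a f` is below the join of the `a g`, for `g` an immediate successor of `f`, and
* at limit levels `a f` is the meet of the elements at the predecessors of `f`,

and for each bar `U`, the element at the root is the join, over the minimal elements `f` of `U`, of
the meets of the elements on the path from the root to `f` (both included). -/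
def IsKDistributive (κ : Cardinal.{u}) (L : Type u) [Lattice L] (S : Set (Set L)) : Prop :=
  ∀ a : SeqNode κ → L,
    (∀ f : SeqNode κ, (#(a '' f.children) < κ ∨ a '' f.children ∈ S) ∧
      ∃ j : L, IsLUB (a '' f.children) j ∧ a f ≤ j) →
    (∀ f : SeqNode κ, IsSuccLimit f.level →
      IsGLB (a '' {h | h.IsPrefix f ∧ h.level < f.level}) (a f)) →
    ∀ U : Set (SeqNode κ), SeqNode.IsBar U → ∀ r : SeqNode κ, r.level = 0 →
      IsLUB {m : L | ∃ f ∈ SeqNode.minimals U, IsGLB (a '' {h | h.IsPrefix f}) m} (a r)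

/-! ### `κ`-complete and `κ`-prime filters, `κ`-complete ideals -/

/-- A filter is `κ`-complete if it is closed under meets of fewer than `κ` many elements. -/
def IsKCompleteFilter (κ : Cardinal.{u}) {L : Type u} [Lattice L] (F : Order.PFilter L) : Prop :=
  ∀ A : Set L, #A < κ → (∀ a ∈ A, a ∈ F) → ∀ m : L, IsGLB A m → m ∈ F

/-- A filter is `κ`-prime if, whenever it contains a join of fewer than `κ` many elements, it
contains one of them. (For the empty join this says that the filter is proper.) -/
def IsKPrimeFilter (κ : Cardinal.{u}) {L : Type u} [Lattice L] (F : Order.PFilter L) : Prop :=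
  ∀ A : Set L, #A < κ → ∀ j : L, IsLUB A j → j ∈ F → ∃ a ∈ A, a ∈ F

/-- An ideal is `κ`-complete if it is closed under joins of fewer than `κ` many elements. -/
def IsKCompleteIdeal (κ : Cardinal.{u}) {L : Type u} [Lattice L] (I : Order.Ideal L) : Prop :=
  ∀ A : Set L, #A < κ → (∀ a ∈ A, a ∈ I) → ∀ j : L, IsLUB A j → j ∈ I

/-!
The prime filter is generated by a branch of a tree of decisions. Since `κ` is a regular strong
limit and `#L ≤ κ`, all pairs `(p β, A β)` of an element of `F` and a nonempty set of fewer than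
`κ` elements of `L` can be listed in type `κ`, each of them cofinally often. Starting at the top
and taking meets at limits, an element `x` reached after `β` steps is replaced by `x ⊓ p β`, and,
if `x ⊓ p β` is below the join of `A β`, by `x ⊓ p β ⊓ y` for some choice of `y ∈ A β`
(`decisionStep`, `decisionValue`). If the elements on a branch stay outside `I`, the filter `P`
generated by them is disjoint from `I` by construction, is `κ`-complete because `κ` is regular, and
contains `F` because every `p ∈ F` is listed. It is `κ`-prime: if an element of the branch is below
the join of a set, then that set is listed at a later step, and a member of it was chosen there.

Such a branch exists by the tree property, in the form of the compactness principle
`IsWeaklyCompact.exists_forall_of_forall_exists`, provided that for each `γ < κ` some choices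
lead to an element outside `I` after `γ` steps (`exists_decisionValue_notMem`). Let `q ∈ F` be the
meet of the `p β`, `β < γ`. After taking meets with `q`, the steps `x ↦ x ⊓ p β` do not lose
anything below level `γ`, so every node is below the join of its children; this uses that binary
meets distribute over joins of fewer than `κ` elements, which is itself an instance of
`κ`-distributivity (`IsKDistributive.le_of_forall_inf_le`). The bar of all nodes of level at least
`γ` then shows that `q` is below the join of the elements reached after `γ` steps. There are fewer
than `κ` of these, so if all of them were in `I`, then `q` would be in `F ∩ I`.
-/

/-! ### Cardinal arithmetic at a regular strong limit -/

theorem Cardinal.mk_pi_lt {κ : Cardinal.{u}} (hr : κ.IsRegular) (hs : κ.IsStrongLimit)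
    {ι : Type u} (hι : #ι < κ) {X : ι → Type u} (hX : ∀ i, #(X i) < κ) : #(∀ i, X i) < κ := by
  set μ := ⨆ i, #(X i) with hμ
  have hμκ : μ < κ := iSup_lt_of_lt_cof_ord (by rwa [hr.cof_ord]) hX
  calc #(∀ i, X i) = Cardinal.prod fun i => #(X i) := mk_pi X
    _ ≤ Cardinal.prod fun _ : ι => μ :=
      prod_le_prod _ _ fun i => le_ciSup bddAbove_of_small i
    _ = μ ^ #ι := prod_const' ι μ
    _ ≤ (2 ^ μ) ^ #ι := power_le_power_right (cantor μ).le
    _ = 2 ^ (μ * #ι) := (power_mul).symm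
    _ < κ := hs.isStrongPrelimit (mul_lt_of_lt hs.aleph0_le hμκ hι)

theorem Cardinal.mk_range_Iio_lt {κ : Cardinal.{u}} {L : Type u} {α : Ordinal.{u}}
    (hα : α < κ.ord) (f : Set.Iio α → L) : #(Set.range f) < κ := by
  have h : Set.range f = Set.range (f ∘ Ordinal.ToType.mk.symm) :=
    (Ordinal.ToType.mk.symm.surjective.range_comp f).symm
  rw [h]
  exact mk_range_le.trans_lt (by simpa using lt_ord.1 hα)

/-- A set whose elements `y` are determined by sequences `φ y ∈ ∏_{β < γ} A β` with `γ < κ` has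
fewer than `κ` elements. -/
theorem Cardinal.mk_lt_of_injOn_pi_Iio {κ : Cardinal.{u}} (hr : κ.IsRegular) (hs : κ.IsStrongLimit)
    {L Y : Type u} {A : Ordinal.{u} → Set L} (hA : ∀ β < κ.ord, #(A β) < κ)
    {γ : Ordinal.{u}} (hγ : γ < κ.ord) {s : Set Y} (φ : Y → Ordinal.{u} → L)
    (hφ : ∀ y ∈ s, ∀ β < γ, φ y β ∈ A β)
    (hinj : ∀ y ∈ s, ∀ z ∈ s, (∀ β < γ, φ y β = φ z β) → y = z) : #s < κ := by
  have hι : #γ.ToType < κ := by simpa using lt_ord.1 hγ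
  refine lt_of_le_of_lt ?_ (mk_pi_lt hr hs hι
    (X := fun i => A i.toOrd) fun i => hA _ (i.toOrd.2.trans hγ))
  refine mk_le_of_injective
    (f := fun (y : s) (i : γ.ToType) => (⟨φ y i.toOrd, hφ y y.2 _ i.toOrd.2⟩ : A i.toOrd)) ?_
  intro y z hyz
  refine Subtype.ext (hinj y y.2 z z.2 fun β hβ => ?_)
  have := congrFun hyz (Ordinal.ToType.mk ⟨β, hβ⟩)
  simpa using this

/-- The part of `κ^{<κ} = κ`, for a regular strong limit `κ`, that counts small subsets. -/
theorem Cardinal.mk_subsets_lt_le {κ : Cardinal.{u}} (hr : κ.IsRegular) (hs : κ.IsStrongLimit)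
    {L : Type u} (hL : #L ≤ κ) : #{A : Set L // #A < κ} ≤ κ := by
  have hK : #κ.ord.ToType = κ := by simp
  have h := mk_subset_mk_lt_cof (α := κ.ord.ToType) (by rw [hK]; exact hs.isStrongPrelimit)
  rw [hK, hr.cof_ord] at h
  obtain ⟨i⟩ := (Cardinal.le_def _ _).1 (hL.trans_eq hK.symm)
  refine le_trans ?_ h.le
  refine mk_le_of_injective (f := fun A => ⟨i '' A.1, mk_image_le.trans_lt A.2⟩) ?_
  intro A B hAB
  exact Subtype.ext (i.injective.image_injective (congrArg Subtype.val hAB))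

/-- A book-keeping function: every element of `X` is listed cofinally often below `κ`. -/
theorem Cardinal.exists_cofinal_enumeration {κ : Cardinal.{u}} (h : ℵ₀ ≤ κ) {X : Type u}
    [Nonempty X] (hX : #X ≤ κ) : ∃ e : Ordinal.{u} → X, ∀ x : X, ∀ β < κ.ord,
      ∃ α, β ≤ α ∧ α < κ.ord ∧ e α = x := by
  have hK : #κ.ord.ToType = κ := by simp
  have hκ0 : κ ≠ 0 := (aleph0_pos.trans_le h).ne'
  have : Nonempty κ.ord.ToType := mk_ne_zero_iff.1 (by rwa [hK])
  have hle : #(X × κ.ord.ToType) ≤ #κ.ord.ToType := by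
    rw [mk_prod, lift_id, lift_id, hK]
    exact (mul_le_mul' hX le_rfl).trans (mul_eq_self h).le
  obtain ⟨i⟩ := (Cardinal.le_def _ _).1 hle
  have hg : Function.Surjective (Function.invFun i) := Function.invFun_surjective i.injective
  set g := Function.invFun i
  refine ⟨fun α => if hα : α < κ.ord then (g (Ordinal.ToType.mk ⟨α, hα⟩)).1
    else Classical.arbitrary X, fun x β hβ => ?_⟩
  by_contra! hcon
  -- the fibre over `x` would lie below `β`, but it maps onto `κ`
  have hsurj : κ ≤ #β.ToType := by
    rw [← hK]
    refine mk_le_of_surjective (f := fun k : β.ToType =>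
      (g (Ordinal.ToType.mk ⟨k.toOrd.1, (Set.mem_Iio.1 k.toOrd.2).trans hβ⟩)).2) fun k => ?_
    obtain ⟨j, hj⟩ := hg (x, k)
    have hjβ : (j.toOrd).1 < β := by
      by_contra! hle
      refine hcon _ hle j.toOrd.2 ?_
      exact (dif_pos (Set.mem_Iio.1 j.toOrd.2)).trans
        ((congrArg (fun t => (g t).1) (Ordinal.ToType.mk.apply_symm_apply j)).trans (by rw [hj]))
    refine ⟨Ordinal.ToType.mk ⟨_, Set.mem_Iio.2 hjβ⟩, ?_⟩
    simp [hj]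
  have := lt_ord.1 hβ
  simp at hsurj
  exact this.not_ge hsurj

/-! ### Compactness of systems of codes -/

section Branch

open Ordinal

variable {κ : Cardinal.{u}} {L : Type u}

/-- Extension of a function on `κ` to all ordinals by the value `d`. -/
noncomputable def extendCode (d : L) (c : κ.ord.ToType → L) (β : Ordinal.{u}) : L :=
  if h : β < κ.ord then c (ToType.mk ⟨β, h⟩) else d

/-- The tree of all `c ∈ ∏_{β < α} A β`, `α < κ`, that satisfy `G α`, ordered by extension. To keep
it in the universe of `κ`, a node is a pair of a level and of a function on all of `κ` that
takes the value `d` from that level on. -/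
def CodeTree (κ : Cardinal.{u}) (A : Ordinal.{u} → Set L)
    (G : Ordinal.{u} → (Ordinal.{u} → L) → Prop) (d : L) : Type u :=
  {x : κ.ord.ToType × (κ.ord.ToType → L) //
    (∀ k < x.1, x.2 k ∈ A k.toOrd) ∧ (∀ k, x.1 ≤ k → x.2 k = d) ∧ G x.1.toOrd (extendCode d x.2)}

namespace CodeTree

variable {A : Ordinal.{u} → Set L} {G : Ordinal.{u} → (Ordinal.{u} → L) → Prop} {d : L}

instance : PartialOrder (CodeTree κ A G d) where
  le x y := x.1.1 ≤ y.1.1 ∧ ∀ k < x.1.1, x.1.2 k = y.1.2 k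
  le_refl x := ⟨le_rfl, fun _ _ => rfl⟩
  le_trans x y z hxy hyz :=
    ⟨hxy.1.trans hyz.1, fun k hk => (hxy.2 k hk).trans (hyz.2 k (hk.trans_le hxy.1))⟩
  le_antisymm x y hxy hyx := by
    have h1 : x.1.1 = y.1.1 := le_antisymm hxy.1 hyx.1
    refine Subtype.ext (Prod.ext h1 (funext fun k => ?_))
    rcases lt_or_ge k x.1.1 with hk | hk
    · exact hxy.2 k hk
    · rw [x.2.2.1 k hk, y.2.2.1 k (h1 ▸ hk)]

theorem fst_lt_of_lt {x y : CodeTree κ A G d} (h : x < y) : x.1.1 < y.1.1 := by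
  refine lt_of_le_of_ne h.le.1 fun he => h.not_ge ⟨he.ge, fun k hk => ?_⟩
  exact (h.le.2 k (he ▸ hk)).symm

theorem lt_of_le_of_fst_lt {x y : CodeTree κ A G d} (h : x ≤ y) (h1 : x.1.1 < y.1.1) : x < y :=
  lt_of_le_of_ne h fun he => h1.ne (by rw [he])

/-- The predecessors of a node are its restrictions, one for each smaller level. -/
noncomputable def predIso
    (hcongr : ∀ α c d, (∀ β < α, c β = d β) → G α c → G α d)
    (hmono : ∀ α β c, α ≤ β → β < κ.ord → G β c → G α c) (x : CodeTree κ A G d) :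
    (fun y z : {y : CodeTree κ A G d // y < x} => y < z) ≃r
      (fun k l : Set.Iio x.1.1 => k < l) where
  toFun y := ⟨y.1.1.1, fst_lt_of_lt y.2⟩
  invFun k := ⟨⟨(k.1, fun l => if l < k.1 then x.1.2 l else d), by
      refine ⟨fun l hl => ?_, fun l hl => if_neg hl.not_gt, ?_⟩
      · simp only [if_pos hl]
        exact x.2.1 l (hl.trans k.2)
      · refine hcongr _ (extendCode d x.1.2) _ (fun β hβ => ?_)
          (hmono _ _ _ ?_ x.1.1.toOrd.2 x.2.2.2)
        · have hβκ : β < κ.ord := lt_trans hβ k.1.toOrd.2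
          have : ToType.mk ⟨β, hβκ⟩ < k.1 := by
            rw [← OrderIso.lt_symm_apply]
            exact hβ
          simp [extendCode, hβκ, this]
        · exact (ToType.mk.symm.monotone k.2.le : k.1.toOrd ≤ x.1.1.toOrd)⟩,
    lt_of_le_of_fst_lt ⟨k.2.le, fun l hl => if_pos hl⟩ k.2⟩
  left_inv y := by
    refine Subtype.ext (Subtype.ext (Prod.ext rfl (funext fun l => ?_)))
    simp only
    split_ifs with hl
    · exact (y.2.le.2 l hl).symm
    · exact (y.1.2.2.1 l (not_lt.1 hl)).symm
  right_inv k := rfl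
  map_rel_iff' := by
    intro y z
    refine ⟨fun h => ?_, fun h => fst_lt_of_lt h⟩
    have h' : y.1.1.1 < z.1.1.1 := h
    refine lt_of_le_of_fst_lt (x := y.1) (y := z.1) ⟨h'.le, fun k hk => ?_⟩ h'
    rw [y.2.le.2 k hk, z.2.le.2 k (hk.trans h')]

theorem extendCode_mem (x : CodeTree κ A G d) {β : Ordinal.{u}} (hβ : β < x.1.1.toOrd.1) :
    extendCode d x.1.2 β ∈ A β := by
  have hβκ : β < κ.ord := lt_trans hβ x.1.1.toOrd.2
  have := x.2.1 (ToType.mk ⟨β, hβκ⟩) ((OrderIso.lt_symm_apply ..).1 hβ)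
  simpa [extendCode, hβκ] using this

theorem extendCode_eq_of_le {x y : CodeTree κ A G d} (h : x ≤ y) {β : Ordinal.{u}}
    (hβ : β < x.1.1.toOrd.1) : extendCode d x.1.2 β = extendCode d y.1.2 β := by
  have hβκ : β < κ.ord := lt_trans hβ x.1.1.toOrd.2
  have := h.2 (ToType.mk ⟨β, hβκ⟩) ((OrderIso.lt_symm_apply ..).1 hβ)
  simpa [extendCode, hβκ] using this

end CodeTree

/-- Compactness: if the conditions `G α`, `α < κ`, on the first `α` coordinates of an element of
`∏_{β < κ} A β` become stronger as `α` grows, each of them can be satisfied, and the sets `A β` have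
fewer than `κ` elements, then all of them can be satisfied together. -/
theorem IsWeaklyCompact.exists_forall_of_forall_exists (hκ : IsWeaklyCompact κ) [Nonempty L]
    {A : Ordinal.{u} → Set L} (hA : ∀ β < κ.ord, #(A β) < κ)
    {G : Ordinal.{u} → (Ordinal.{u} → L) → Prop}
    (hcongr : ∀ α c d, (∀ β < α, c β = d β) → G α c → G α d)
    (hmono : ∀ α β c, α ≤ β → β < κ.ord → G β c → G α c)
    (hex : ∀ α < κ.ord, ∃ c : Ordinal.{u} → L, (∀ β < α, c β ∈ A β) ∧ G α c) :
    ∃ c : Ordinal.{u} → L, (∀ β < κ.ord, c β ∈ A β) ∧ ∀ α < κ.ord, G α c := by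
  obtain ⟨d⟩ := ‹Nonempty L›
  have hT : IsSetTree (CodeTree κ A G d) := fun x =>
    (CodeTree.predIso hcongr hmono x).toRelEmbedding.isWellOrder
  have hheight : ∀ x, hT.height x = x.1.1.toOrd := fun x => by
    have := hT x
    exact (CodeTree.predIso hcongr hmono x).ordinalType_congr
  obtain ⟨C, hC, hlev⟩ := hκ.treeProperty (CodeTree κ A G d) hT
    (fun x => by rw [hheight]; exact x.1.1.toOrd.2) fun α hα => by
      constructor
      · obtain ⟨c, hc, hG⟩ := hex α hα
        refine ⟨⟨(ToType.mk ⟨α, hα⟩, fun k => if k.toOrd < α then c k.toOrd else d),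
          ?_, ?_, ?_⟩, ?_⟩
        · intro k hk
          have : k.toOrd < α := OrderIso.symm_apply_lt .. |>.2 hk
          simp only [if_pos this]
          exact hc _ this
        · intro k hk
          refine if_neg (not_lt.2 ?_)
          exact (OrderIso.le_symm_apply ..).2 hk
        · have hcode : ∀ β < α, c β = extendCode d
              (fun k : κ.ord.ToType => if k.toOrd < α then c k.toOrd else d) β := by
            intro β hβ
            simp [extendCode, hβ.trans hα, hβ]
          simpa using hcongr _ _ _ hcode hG
        · exact (hheight _).trans (by simp)
      · refine mk_lt_of_injOn_pi_Iio hκ.isRegular hκ.isStrongLimit hA hα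
          (fun x : CodeTree κ A G d => extendCode d x.1.2) ?_ ?_
        · intro x hx β hβ
          have hx : x.1.1.toOrd.1 = α := (hheight x).symm.trans hx
          exact CodeTree.extendCode_mem x (hx ▸ hβ)
        · intro x hx y hy hxy
          have hx : x.1.1.toOrd.1 = α := (hheight x).symm.trans hx
          have hy : y.1.1.toOrd.1 = α := (hheight y).symm.trans hy
          have h1 : x.1.1 = y.1.1 := ToType.mk.symm.injective (Subtype.ext (hx.trans hy.symm))
          have hle : ∀ {x y : CodeTree κ A G d}, x.1.1.toOrd.1 = α → x.1.1 = y.1.1 →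
              (∀ β < α, extendCode d x.1.2 β = extendCode d y.1.2 β) → x ≤ y := by
            intro x y hx h1 hxy
            refine ⟨h1.le, fun k hk => ?_⟩
            have hk' : k.toOrd.1 < α := hx ▸ (ToType.mk.symm.strictMono hk : k.toOrd < x.1.1.toOrd)
            have hkκ : k.toOrd.1 < κ.ord := k.toOrd.2
            have hk₀ : ToType.mk ⟨k.toOrd.1, hkκ⟩ = k := ToType.mk.apply_symm_apply k
            have := hxy _ hk'
            rwa [extendCode, extendCode, dif_pos hkκ, dif_pos hkκ, hk₀] at this
          exact le_antisymm (hle hx h1 hxy) (hle hy h1.symm fun β hβ => (hxy β hβ).symm)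
  have : Nonempty (CodeTree κ A G d) :=
    ⟨(hlev 0 (ord_pos.2 (aleph0_pos.trans_le hκ.isStrongLimit.aleph0_le))).choose⟩
  choose! x hxC hx using hlev
  have hx : ∀ α < κ.ord, (x α).1.1.toOrd.1 = α := fun α hα => (hheight _).symm.trans (hx α hα)
  -- two nodes of the branch agree at all coordinates at which both are defined
  have hagree : ∀ α < κ.ord, ∀ α' < κ.ord, ∀ β < α, β < α' →
      extendCode d (x α).1.2 β = extendCode d (x α').1.2 β := by
    intro α hα α' hα' β hβ hβ'
    rcases hC.total (hxC α hα) (hxC α' hα') with h | h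
    · exact CodeTree.extendCode_eq_of_le h ((hx α hα).symm ▸ hβ)
    · exact (CodeTree.extendCode_eq_of_le h ((hx α' hα').symm ▸ hβ')).symm
  have hlim : IsSuccLimit κ.ord := isSuccLimit_ord hκ.isStrongLimit.aleph0_le
  refine ⟨fun β => extendCode d (x (succ β)).1.2 β, fun β hβ => ?_, fun α hα => ?_⟩
  · have hβ' := hlim.succ_lt hβ
    exact CodeTree.extendCode_mem _ ((hx _ hβ').symm ▸ lt_succ β)
  · refine hcongr α (extendCode d (x α).1.2) _ (fun β hβ => ?_) ?_
    · exact hagree α hα _ (hlim.succ_lt (hβ.trans hα)) β hβ (lt_succ β)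
    · have := (x α).2.2.2
      rwa [hx α hα] at this

end Branch

/-! ### Nodes of `κ^{<κ}` -/

namespace SeqNode

variable {κ : Cardinal.{u}} {L : Type u}

/-- The restriction of a node to a smaller level. -/
def restrict (f : SeqNode κ) (α : Ordinal.{u}) (h : α ≤ f.level) : SeqNode κ where
  level := α
  level_lt := h.trans_lt f.level_lt
  val i := f.val ⟨i.1, lt_of_lt_of_le i.2 h⟩

theorem restrict_isPrefix (f : SeqNode κ) {α : Ordinal.{u}} (h : α ≤ f.level) :
    (f.restrict α h).IsPrefix f :=
  ⟨h, fun _ => rfl⟩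

theorem isPrefix_refl (f : SeqNode κ) : f.IsPrefix f :=
  ⟨le_rfl, fun _ => rfl⟩

/-- The immediate successor of `f` with last entry `i`. -/
noncomputable def snoc (f : SeqNode κ) (i : Set.Iio κ.ord) (h : succ f.level < κ.ord) :
    SeqNode κ where
  level := succ f.level
  level_lt := h
  val k := if hk : k.1 < f.level then f.val ⟨k.1, hk⟩ else i

theorem snoc_mem_children (f : SeqNode κ) (i : Set.Iio κ.ord) (h : succ f.level < κ.ord) :
    f.snoc i h ∈ f.children := by
  refine ⟨⟨le_succ _, fun k => ?_⟩, rfl⟩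
  have hk : k.1 < f.level := k.2
  simp [snoc, hk]

/-- The sequence of elements of `L` coded by a node, when `en β` translates the entries at `β`; it
is `d` from the level of the node on. -/
noncomputable def decode (en : Ordinal.{u} → Set.Iio κ.ord → L) (d : L) (f : SeqNode κ)
    (β : Ordinal.{u}) : L :=
  if h : β < f.level then en β (f.val ⟨β, h⟩) else d

variable {en : Ordinal.{u} → Set.Iio κ.ord → L} {d : L}

theorem IsPrefix.decode_eq {f g : SeqNode κ} (h : f.IsPrefix g) {β : Ordinal.{u}}
    (hβ : β < f.level) : decode en d f β = decode en d g β := by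
  rw [decode, decode, dif_pos hβ, dif_pos (hβ.trans_le h.1), h.2]

theorem decode_mem {A : Ordinal.{u} → Set L} (hen : ∀ β, Set.range (en β) = A β) {f : SeqNode κ}
    {β : Ordinal.{u}} (hβ : β < f.level) : decode en d f β ∈ A β := by
  rw [decode, dif_pos hβ, ← hen]
  exact Set.mem_range_self _

theorem exists_mem_children_decode_eq {A : Ordinal.{u} → Set L}
    (hen : ∀ β, Set.range (en β) = A β) (f : SeqNode κ) (h : succ f.level < κ.ord) {x : L}
    (hx : x ∈ A f.level) : ∃ g ∈ f.children, decode en d g f.level = x := by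
  rw [← hen] at hx
  obtain ⟨i, rfl⟩ := hx
  refine ⟨f.snoc i h, f.snoc_mem_children i h, ?_⟩
  rw [decode, dif_pos (show f.level < (f.snoc i h).level from lt_succ _)]
  simp [snoc]

theorem image_children_eq_singleton {a : SeqNode κ → L} (hlim : IsSuccLimit κ.ord) (f : SeqNode κ)
    (h : ∀ g ∈ f.children, a g = a f) : a '' f.children = {a f} := by
  refine Set.eq_singleton_iff_unique_mem.2 ⟨?_, ?_⟩
  · have hg := f.snoc_mem_children ⟨0, hlim.bot_lt⟩ (hlim.succ_lt f.level_lt)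
    exact ⟨_, hg, h _ hg⟩
  · rintro _ ⟨g, hg, rfl⟩
    exact h g hg

theorem isBar_le_level {γ : Ordinal.{u}} (hγ : γ < κ.ord) : IsBar {f : SeqNode κ | γ ≤ f.level} :=
  ⟨fun _ hf _ hg => le_trans hf hg.1,
    fun x => ⟨⟨γ, hγ, fun i => x ⟨i.1, lt_trans i.2 hγ⟩⟩, le_refl γ, fun _ => rfl⟩⟩

theorem level_eq_of_mem_minimals {γ : Ordinal.{u}} {f : SeqNode κ}
    (hf : f ∈ minimals {f : SeqNode κ | γ ≤ f.level}) : f.level = γ := by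
  have h : γ ≤ f.level := hf.1
  exact (congrArg level (hf.2 (f.restrict γ h) (le_refl γ) (f.restrict_isPrefix h))).symm

end SeqNode

theorem exists_range_Iio_eq {κ : Cardinal.{u}} {L : Type u} {A : Set L} (hA : A.Nonempty)
    (hAκ : #A < κ) : ∃ en : Set.Iio κ.ord → L, Set.range en = A := by
  have hK : #κ.ord.ToType = κ := by simp
  obtain ⟨i⟩ := (Cardinal.le_def _ _).1 (hAκ.le.trans_eq hK.symm)
  have : Nonempty A := hA.to_subtype
  refine ⟨fun k => (Function.invFun i (Ordinal.ToType.mk k) : A), ?_⟩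
  have hs : Function.Surjective fun k : Set.Iio κ.ord => Function.invFun i (Ordinal.ToType.mk k) :=
    (Function.invFun_surjective i.injective).comp Ordinal.ToType.mk.surjective
  rw [show (fun k : Set.Iio κ.ord => ((Function.invFun i (Ordinal.ToType.mk k) : A) : L)) =
    Subtype.val ∘ fun k : Set.Iio κ.ord => Function.invFun i (Ordinal.ToType.mk k) from rfl,
    hs.range_comp, Subtype.range_coe]

/-! ### Consequences of `κ`-distributivity -/

section Distrib

variable {κ : Cardinal.{u}} {L : Type u} [Lattice L] {S : Set (Set L)}

/-- `κ`-distributivity for the bar of all nodes of level at least `γ`. -/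
theorem IsKDistributive.le_of_forall_level_eq (hd : IsKDistributive κ L S) {a : SeqNode κ → L}
    (hchild : ∀ f : SeqNode κ, #(a '' f.children) < κ ∧
      ∃ j : L, IsLUB (a '' f.children) j ∧ a f ≤ j)
    (hlimit : ∀ f : SeqNode κ, IsSuccLimit f.level →
      IsGLB (a '' {h | h.IsPrefix f ∧ h.level < f.level}) (a f))
    {γ : Ordinal.{u}} (hγ : γ < κ.ord) {k : L}
    (hk : ∀ f : SeqNode κ, f.level = γ → ∀ m, (∀ h : SeqNode κ, h.IsPrefix f → m ≤ a h) → m ≤ k)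
    {r : SeqNode κ} (hr : r.level = 0) : a r ≤ k := by
  have h := hd a (fun f => ⟨Or.inl (hchild f).1, (hchild f).2⟩) hlimit _
    (SeqNode.isBar_le_level hγ) r hr
  refine h.2 ?_
  rintro m ⟨f, hf, hm⟩
  exact hk f (SeqNode.level_eq_of_mem_minimals hf) m
    fun h hh => hm.1 (Set.mem_image_of_mem a hh)

/-- Binary meets distribute over joins of fewer than `κ` elements. The family used for this takes
the value `w` at the root and the elements of `A` at the levels from `1` up to `ω`, where
the limit condition forces the values `w ⊓ x`; the meets on the paths up to level `1` are the
elements `w ⊓ x` already. -/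
theorem IsKDistributive.le_of_forall_inf_le (hκ : IsWeaklyCompact κ)
    (hd : IsKDistributive κ L S) {A : Set L} (hA : A.Nonempty) (hAκ : #A < κ) {j w k : L}
    (hj : IsLUB A j) (hwj : w ≤ j) (hk : ∀ x ∈ A, w ⊓ x ≤ k) : w ≤ k := by
  have hlim : IsSuccLimit κ.ord := isSuccLimit_ord hκ.isStrongLimit.aleph0_le
  obtain ⟨en, hen⟩ := exists_range_Iio_eq hA hAκ
  have hen' : ∀ β : Ordinal.{u}, Set.range ((fun _ => en) β) = (fun _ => A) β := fun _ => hen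
  set x : SeqNode κ → L := fun f => SeqNode.decode (fun _ => en) w f 0
  have hxA : ∀ f : SeqNode κ, f.level ≠ 0 → x f ∈ A := fun f hf =>
    SeqNode.decode_mem hen' (pos_iff_ne_zero.2 hf)
  have hx : ∀ f g : SeqNode κ, f.IsPrefix g → f.level ≠ 0 → x f = x g := fun f g h hf =>
    h.decode_eq (pos_iff_ne_zero.2 hf)
  set a : SeqNode κ → L := fun f =>
    if f.level = 0 then w else if f.level < Ordinal.omega0 then x f else w ⊓ x f with ha
  have ha0 : ∀ f : SeqNode κ, f.level = 0 → a f = w := fun f hf => if_pos hf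
  have ha1 : ∀ f : SeqNode κ, f.level ≠ 0 → f.level < Ordinal.omega0 → a f = x f :=
    fun f hf hf' => by simp [ha, hf, hf']
  have ha2 : ∀ f : SeqNode κ, Ordinal.omega0 ≤ f.level → a f = w ⊓ x f := fun f hf => by
    have h0 : f.level ≠ 0 := (Ordinal.omega0_pos.trans_le hf).ne'
    simp [ha, h0, hf.not_gt]
  have h1κ : (1 : Ordinal.{u}) < κ.ord := by
    simpa using hlim.succ_lt hlim.bot_lt
  have hr : (⟨0, hlim.bot_lt, fun i => ⟨0, hlim.bot_lt⟩⟩ : SeqNode κ).level = 0 := rfl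
  rw [← ha0 _ hr]
  refine hd.le_of_forall_level_eq (a := a) (fun f => ?_) (fun f hf => ?_) h1κ
    (fun f hf m hm => ?_) hr
  · by_cases hf : f.level = 0
    · have himage : a '' f.children = A := by
        have hag : ∀ g ∈ f.children, a g = x g ∧ g.level ≠ 0 := fun g hg => by
          have hg1 : g.level = 1 := by rw [hg.2, hf]; simp
          have hg0 : g.level ≠ 0 := by rw [hg1]; exact one_ne_zero
          exact ⟨ha1 g hg0 (hg1 ▸ Ordinal.one_lt_omega0), hg0⟩
        refine Set.Subset.antisymm ?_ fun y hy => ?_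
        · rintro _ ⟨g, hg, rfl⟩
          rw [(hag g hg).1]
          exact hxA g (hag g hg).2
        · obtain ⟨g, hg, hgy⟩ := SeqNode.exists_mem_children_decode_eq (d := w) hen' f
            (hlim.succ_lt f.level_lt) hy
          rw [hf] at hgy
          exact ⟨g, hg, (hag g hg).1.trans hgy⟩
      rw [himage, ha0 f hf]
      exact ⟨hAκ, j, hj, hwj⟩
    · have himage := SeqNode.image_children_eq_singleton (a := a) hlim f fun g hg => by
        have hg0 : g.level ≠ 0 := by
          rw [hg.2]
          exact ((zero_le (a := f.level)).trans_lt (lt_succ _)).ne'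
        have hgω : g.level < Ordinal.omega0 ↔ f.level < Ordinal.omega0 := by
          rw [hg.2]
          exact Ordinal.isSuccLimit_omega0.succ_lt_iff
        simp only [ha, hg0, hf, if_false, hgω, hx f g hg.1 hf]
      rw [himage]
      refine ⟨?_, a f, isLUB_singleton, le_rfl⟩
      rw [mk_singleton]
      exact one_lt_aleph0.trans_le hκ.isStrongLimit.aleph0_le
  · have hω : Ordinal.omega0 ≤ f.level := Ordinal.omega0_le_of_isSuccLimit hf
    rw [ha2 f hω]
    constructor
    · rintro _ ⟨h, ⟨hhf, -⟩, rfl⟩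
      by_cases h0 : h.level = 0
      · rw [ha0 h h0]
        exact inf_le_left
      · rw [← hx h f hhf h0]
        rcases lt_or_ge h.level Ordinal.omega0 with h1 | h1
        · rw [ha1 h h0 h1]
          exact inf_le_right
        · rw [ha2 h h1]
    · intro m hm
      have h0 : (0 : Ordinal.{u}) < f.level := Ordinal.omega0_pos.trans_le hω
      have h1 : (1 : Ordinal.{u}) < f.level := Ordinal.one_lt_omega0.trans_le hω
      refine le_inf ?_ ?_
      · have := hm (Set.mem_image_of_mem a ⟨f.restrict_isPrefix h0.le, h0⟩)
        rwa [ha0 _ rfl] at this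
      · have := hm (Set.mem_image_of_mem a ⟨f.restrict_isPrefix h1.le, h1⟩)
        have h1' : (f.restrict 1 h1.le).level ≠ 0 := one_ne_zero
        rwa [ha1 _ h1' Ordinal.one_lt_omega0, hx _ f (f.restrict_isPrefix h1.le) h1'] at this
  · have hf0 : f.level ≠ 0 := by rw [hf]; exact one_ne_zero
    have hm0 := hm _ (f.restrict_isPrefix zero_le)
    rw [ha0 _ rfl] at hm0
    have hm1 := hm f f.isPrefix_refl
    rw [ha1 f hf0 (hf ▸ Ordinal.one_lt_omega0)] at hm1
    exact (le_inf hm0 hm1).trans (hk _ (hxA f hf0))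

end Distrib

/-! ### The decision tree of a sequence of joins -/

section Decision

variable {κ : Cardinal.{u}} {L : Type u} [Lattice L]

/-- One step of the construction: first `x` is cut down to `x ⊓ p β`; if this is below the `β`-th
join `j β`, then it is cut down further to the member `y` chosen from the joined set. -/
noncomputable def decisionStep (p j : Ordinal.{u} → L) (β : Ordinal.{u}) (x y : L) : L :=
  open Classical in if x ⊓ p β ≤ j β then x ⊓ p β ⊓ y else x ⊓ p β

/-- The element reached after `α` steps, starting at the top and taking meets at limits, when the
choices are `c`. -/
noncomputable def decisionValue [Nonempty L] (p j c : Ordinal.{u} → L) (α : Ordinal.{u}) : L :=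
  Classical.epsilon fun m => IsGLB
    (Set.range fun β : Set.Iio α => decisionStep p j β (decisionValue p j c β) (c β)) m
termination_by α
decreasing_by exact β.2

variable {p j c c' : Ordinal.{u} → L} {α β : Ordinal.{u}}

theorem decisionStep_le_inf (x y : L) : decisionStep p j β x y ≤ x ⊓ p β := by
  unfold decisionStep
  split_ifs
  · exact inf_le_left
  · exact le_rfl

/-- The element reached after `α` steps depends on the first `α` choices only. -/
theorem decisionValue_congr [Nonempty L] (h : ∀ β < α, c β = c' β) :
    decisionValue p j c α = decisionValue p j c' α := by
  induction α using WellFoundedLT.induction with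
  | ind α ih =>
    have : (fun β : Set.Iio α => decisionStep p j β (decisionValue p j c β) (c β)) =
        fun β : Set.Iio α => decisionStep p j β (decisionValue p j c' β) (c' β) := by
      funext β
      rw [ih β.1 β.2 fun δ hδ => h δ (lt_trans hδ β.2), h β.1 β.2]
    rw [decisionValue, this, ← decisionValue]

section Complete

variable [Nonempty L]

theorem isGLB_decisionValue (hL : IsKComplete κ L) (hα : α < κ.ord) : IsGLB
    (Set.range fun β : Set.Iio α => decisionStep p j β (decisionValue p j c β) (c β))
    (decisionValue p j c α) := by
  rw [decisionValue]
  exact Classical.epsilon_spec (hL _ (mk_range_Iio_lt hα _)).1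

theorem decisionValue_le_decisionStep (hL : IsKComplete κ L) (hα : α < κ.ord) (h : β < α) :
    decisionValue p j c α ≤ decisionStep p j β (decisionValue p j c β) (c β) :=
  (isGLB_decisionValue hL hα).1 ⟨⟨β, h⟩, rfl⟩

theorem le_decisionValue (hL : IsKComplete κ L) (hα : α < κ.ord) {m : L}
    (h : ∀ β < α, m ≤ decisionStep p j β (decisionValue p j c β) (c β)) :
    m ≤ decisionValue p j c α := by
  refine (isGLB_decisionValue hL hα).2 ?_
  rintro _ ⟨β, rfl⟩
  exact h β.1 β.2

theorem decisionValue_le_of_lt (hL : IsKComplete κ L) (hα : α < κ.ord) (h : β < α) :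
    decisionValue p j c α ≤ p β :=
  (decisionValue_le_decisionStep hL hα h).trans ((decisionStep_le_inf _ _).trans inf_le_right)

theorem decisionValue_anti (hL : IsKComplete κ L) (hα : α < κ.ord) (h : β ≤ α) :
    decisionValue p j c α ≤ decisionValue p j c β :=
  le_decisionValue hL (h.trans_lt hα) fun _ hδ =>
    decisionValue_le_decisionStep hL hα (hδ.trans_le h)

theorem decisionValue_succ (hL : IsKComplete κ L) (hα : succ α < κ.ord) :
    decisionValue p j c (succ α) = decisionStep p j α (decisionValue p j c α) (c α) := by
  have hα' : α < κ.ord := (lt_succ α).trans hα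
  refine le_antisymm (decisionValue_le_decisionStep hL hα (lt_succ α)) ?_
  refine le_decisionValue hL hα fun β hβ => ?_
  rcases (lt_succ_iff.1 hβ).eq_or_lt with rfl | h
  · exact le_rfl
  · exact ((decisionStep_le_inf _ _).trans inf_le_left).trans
      (decisionValue_le_decisionStep hL hα' h)

theorem le_decisionValue_of_isSuccLimit (hL : IsKComplete κ L) (hα : α < κ.ord)
    (hlim : IsSuccLimit α) {m : L}
    (h : ∀ β < α, m ≤ decisionValue p j c β) : m ≤ decisionValue p j c α :=
  le_decisionValue hL hα fun β hβ => (h _ (hlim.succ_lt hβ)).trans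
    (decisionValue_le_decisionStep hL ((hlim.succ_lt hβ).trans hα) (lt_succ β))

theorem le_decisionValue_zero (hL : IsKComplete κ L) (hκ : 0 < κ.ord) (m : L) :
    m ≤ decisionValue p j c 0 :=
  le_decisionValue hL hκ fun _ hβ => absurd hβ not_lt_zero

end Complete

end Decision

/-! ### Separation by a prime filter -/

section Separation

variable {κ : Cardinal.{u}} {L : Type u} [Lattice L] [Nonempty L] {S : Set (Set L)}
  {A : Ordinal.{u} → Set L} {p j : Ordinal.{u} → L}

/-- Fewer than `κ` elements are reached after `γ < κ` steps. -/
theorem mk_decisionValues_lt (hκ : IsWeaklyCompact κ) (hA : ∀ β < κ.ord, #(A β) < κ)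
    {γ : Ordinal.{u}} (hγ : γ < κ.ord) :
    #{y : L | ∃ c : Ordinal.{u} → L, (∀ β < γ, c β ∈ A β) ∧ decisionValue p j c γ = y} < κ := by
  set s := {y : L | ∃ c : Ordinal.{u} → L, (∀ β < γ, c β ∈ A β) ∧ decisionValue p j c γ = y}
  have hs : ∀ y ∈ s, ∃ c : Ordinal.{u} → L, (∀ β < γ, c β ∈ A β) ∧ decisionValue p j c γ = y :=
    fun y hy => hy
  choose! φ hφ hφy using hs
  refine mk_lt_of_injOn_pi_Iio hκ.isRegular hκ.isStrongLimit hA hγ φ hφ fun y hy z hz h => ?_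
  rw [← hφy y hy, ← hφy z hz]
  exact decisionValue_congr h

/-- Some choices lead to elements outside the ideal at each level `γ < κ`. Otherwise
distributivity, applied to the bar of all nodes of level at least `γ`, would put the meet `q` of
the elements `p β`, `β < γ`, into the ideal. The family in question consists of the meets with `q`
of the elements of the decision tree, without which a node would not be covered by its
children; from level `γ` on it is constant. -/
theorem exists_decisionValue_notMem (hκ : IsWeaklyCompact κ) (hL : IsKComplete κ L)
    (hd : IsKDistributive κ L S) {F : Order.PFilter L} (hF : IsKCompleteFilter κ F)
    {I : Order.Ideal L} (hI : IsKCompleteIdeal κ I) (hFI : Disjoint (F : Set L) (I : Set L))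
    (hp : ∀ β, p β ∈ F) (hA : ∀ β, (A β).Nonempty) (hAκ : ∀ β, #(A β) < κ)
    (hj : ∀ β, IsLUB (A β) (j β)) {γ : Ordinal.{u}} (hγ : γ < κ.ord) :
    ∃ c : Ordinal.{u} → L, (∀ β < γ, c β ∈ A β) ∧ decisionValue p j c γ ∉ I := by
  by_contra! hcon
  have hlim : IsSuccLimit κ.ord := isSuccLimit_ord hκ.isStrongLimit.aleph0_le
  obtain ⟨d⟩ := ‹Nonempty L›
  have : Nonempty L := ⟨d⟩
  choose en hen using fun β => exists_range_Iio_eq (hA β) (hAκ β)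
  obtain ⟨q, hq⟩ := (hL _ (mk_range_Iio_lt hγ fun β => p β)).1
  have hqp : ∀ β < γ, q ≤ p β := fun β hβ => hq.1 ⟨⟨β, hβ⟩, rfl⟩
  have hqF : q ∈ F := by
    refine hF _ (mk_range_Iio_lt hγ fun β => p β) ?_ q hq
    rintro _ ⟨β, rfl⟩
    exact hp _
  have hVκ := mk_decisionValues_lt (p := p) (j := j) hκ (fun β _ => hAκ β) hγ
  obtain ⟨k, hk⟩ := (hL _ hVκ).2
  have hkI : k ∈ I := by
    refine hI _ hVκ ?_ k hk
    rintro _ ⟨c, hc, rfl⟩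
    exact hcon c hc
  set v : SeqNode κ → Ordinal.{u} → L := fun f α => decisionValue p j (f.decode en d) α
  have hv : ∀ {f g : SeqNode κ}, f.IsPrefix g → ∀ {α}, α ≤ f.level → v f α = v g α :=
    fun {f g} h {α} hα => decisionValue_congr fun β hβ => h.decode_eq (hβ.trans_le hα)
  set a : SeqNode κ → L := fun f => v f (min f.level γ) ⊓ q with ha
  have hale : ∀ {f : SeqNode κ}, f.level ≤ γ → a f = v f f.level ⊓ q := fun {f} hf => by
    simp only [ha, min_eq_left hf]
  have hmin : ∀ α, min α γ < κ.ord := fun α => (min_le_right _ _).trans_lt hγ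
  have hanti : ∀ {f g : SeqNode κ}, f.IsPrefix g → a g ≤ a f := fun {f g} h => by
    refine inf_le_inf_right q ?_
    rw [hv h (min_le_left _ _)]
    exact decisionValue_anti hL (hmin _) (min_le_min_right _ h.1)
  have hroot : (⟨0, hlim.bot_lt, fun i => ⟨0, hlim.bot_lt⟩⟩ : SeqNode κ).level = 0 := rfl
  set r : SeqNode κ := ⟨0, hlim.bot_lt, fun i => ⟨0, hlim.bot_lt⟩⟩
  have hqr : q ≤ a r := by
    rw [hale zero_le]
    exact le_inf (le_decisionValue_zero hL hlim.bot_lt q) le_rfl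
  refine Set.disjoint_left.1 hFI hqF (I.lower (hqr.trans ?_) hkI)
  refine hd.le_of_forall_level_eq (a := a) (fun f => ?_) (fun f hf => ?_) hγ (fun f hf m hm => ?_)
    hroot
  · by_cases hfγ : f.level < γ
    · have hsucc : succ f.level ≤ γ := succ_le_of_lt hfγ
      have hsκ : succ f.level < κ.ord := hsucc.trans_lt hγ
      have hag : ∀ g ∈ f.children, a g =
          decisionStep p j f.level (v f f.level) (g.decode en d f.level) ⊓ q := fun g hg => by
        have h1 : v g (succ f.level) =
            decisionStep p j f.level (v g f.level) (g.decode en d f.level) :=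
          decisionValue_succ hL hsκ
        rw [hale (hg.2.trans_le hsucc), hg.2, h1, ← hv hg.1 le_rfl]
      have hcard : #(a '' f.children) < κ := by
        refine lt_of_le_of_lt (mk_le_mk_of_subset ?_) ((mk_image_le (s := A f.level)
          (f := fun y => decisionStep p j f.level (v f f.level) y ⊓ q)).trans_lt (hAκ _))
        rintro _ ⟨g, hg, rfl⟩
        refine ⟨g.decode en d f.level, SeqNode.decode_mem hen ?_, (hag g hg).symm⟩
        rw [hg.2]
        exact lt_succ _
      obtain ⟨l, hl⟩ := (hL _ hcard).2
      refine ⟨hcard, l, hl, ?_⟩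
      have hal : ∀ y ∈ A f.level, decisionStep p j f.level (v f f.level) y ⊓ q ≤ l := by
        intro y hy
        obtain ⟨g, hg, rfl⟩ := SeqNode.exists_mem_children_decode_eq (d := d) hen f
          (hlim.succ_lt f.level_lt) hy
        rw [← hag g hg]
        exact hl.1 (Set.mem_image_of_mem a hg)
      rw [hale hfγ.le]
      -- `q ≤ p β` for all `β < γ`, so below `q` the cut with `p β` is harmless
      have hx : v f f.level ⊓ q ≤ v f f.level ⊓ p f.level :=
        inf_le_inf_left _ (hqp _ hfγ)
      by_cases hstep : v f f.level ⊓ p f.level ≤ j f.level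
      · refine hd.le_of_forall_inf_le hκ (hA _) (hAκ _) (hj _) (hx.trans hstep) fun y hy => ?_
        refine le_trans ?_ (hal y hy)
        rw [decisionStep, if_pos hstep]
        exact le_inf (inf_le_inf_right y hx) (inf_le_left.trans inf_le_right)
      · obtain ⟨y, hy⟩ := hA f.level
        refine le_trans ?_ (hal y hy)
        rw [decisionStep, if_neg hstep]
        exact le_inf hx inf_le_right
    · have hfγ : γ ≤ f.level := not_lt.1 hfγ
      have himage := SeqNode.image_children_eq_singleton (a := a) hlim f fun g hg => by
        have hgγ : γ ≤ g.level := hfγ.trans hg.1.1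
        simp only [ha, min_eq_right hfγ, min_eq_right hgγ, hv hg.1 hfγ]
      rw [himage]
      refine ⟨?_, a f, isLUB_singleton, le_rfl⟩
      rw [mk_singleton]
      exact one_lt_aleph0.trans_le hκ.isStrongLimit.aleph0_le
  · constructor
    · rintro _ ⟨h, ⟨hhf, -⟩, rfl⟩
      exact hanti hhf
    · intro m hm
      have hm' : ∀ α (hα : α < f.level), m ≤ a (f.restrict α hα.le) := fun α hα =>
        hm (Set.mem_image_of_mem a ⟨f.restrict_isPrefix hα.le, hα⟩)
      have hares : ∀ α (hα : α < f.level), α ≤ γ → a (f.restrict α hα.le) = v f α ⊓ q :=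
        fun α hα hαγ => by
          rw [hale hαγ]
          exact congrArg (· ⊓ q) (hv (f.restrict_isPrefix hα.le) le_rfl)
      rcases le_or_gt f.level γ with hfγ | hfγ
      · rw [hale hfγ]
        have hm'' : ∀ α < f.level, m ≤ v f α ⊓ q := fun α hα =>
          (hm' α hα).trans_eq (hares α hα (hα.le.trans hfγ))
        exact le_inf (le_decisionValue_of_isSuccLimit hL f.level_lt hf fun α hα =>
          (hm'' α hα).trans inf_le_left) ((hm'' 0 hf.bot_lt).trans inf_le_right)
      · refine (hm' γ hfγ).trans_eq ?_
        rw [hares γ hfγ le_rfl]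
        simp only [ha, min_eq_right hfγ.le]
  · refine (hm f f.isPrefix_refl).trans ?_
    rw [hale hf.le, hf]
    exact inf_le_left.trans (hk.1 ⟨_, fun β hβ => SeqNode.decode_mem hen (hf ▸ hβ), rfl⟩)

end Separation

theorem mainTheorem8 (κ : Cardinal.{u}) (hκ : IsWeaklyCompact κ)
    (L : Type u) [Lattice L] [Nontrivial L] (S : Set (Set L))
    (hcomplete : IsKComplete κ L) (hdistrib : IsKDistributive κ L S) (hcard : #L ≤ κ)
    (F : Order.PFilter L) (hF : IsKCompleteFilter κ F)
    (I : Order.Ideal L) (hI : IsKCompleteIdeal κ I)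
    (hFI : Disjoint (F : Set L) (I : Set L)) :
    ∃ P : Order.PFilter L, IsKCompleteFilter κ P ∧ IsKPrimeFilter κ P ∧
      F ≤ P ∧ Disjoint (P : Set L) (I : Set L) := by
  have hω : ℵ₀ ≤ κ := hκ.isStrongLimit.aleph0_le
  have hlim : IsSuccLimit κ.ord := isSuccLimit_ord hω
  -- list all pairs of an element of `F` and a nonempty set of fewer than `κ` elements
  have hsmall : ∀ x : L, #({x} : Set L) < κ := fun x => by
    rw [mk_singleton]
    exact one_lt_aleph0.trans_le hω
  obtain ⟨p₀, hp₀⟩ := F.nonempty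
  have : Nonempty ({x // x ∈ F} × {A : {A : Set L // #A < κ} // A.1.Nonempty}) :=
    ⟨⟨p₀, hp₀⟩, ⟨{p₀}, hsmall p₀⟩, Set.singleton_nonempty p₀⟩
  have hX : #({x // x ∈ F} × {A : {A : Set L // #A < κ} // A.1.Nonempty}) ≤ κ := by
    rw [mk_prod, lift_id, lift_id]
    exact (mul_le_mul' ((mk_subtype_le _).trans hcard) ((mk_subtype_le _).trans
      (mk_subsets_lt_le hκ.isRegular hκ.isStrongLimit hcard))).trans (mul_eq_self hω).le
  obtain ⟨e, he⟩ := exists_cofinal_enumeration hω hX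
  set p : Ordinal.{u} → L := fun β => (e β).1
  set A : Ordinal.{u} → Set L := fun β => (e β).2.1.1
  have hAκ : ∀ β, #(A β) < κ := fun β => (e β).2.1.2
  choose j hj using fun β => (hcomplete (A β) (hAκ β)).2
  obtain ⟨c, hcA, hcI⟩ := hκ.exists_forall_of_forall_exists (A := A)
    (G := fun α c => decisionValue p j c α ∉ I) (fun β _ => hAκ β)
    (fun α c c' h hc => by rwa [← decisionValue_congr h])
    (fun α β c hαβ hβ hc hα => hc (I.lower (decisionValue_anti hcomplete hβ hαβ) hα))
    fun α hα => exists_decisionValue_notMem hκ hcomplete hdistrib hF hI hFI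
      (fun β => (e β).1.2) (fun β => (e β).2.2) hAκ hj hα
  set v := decisionValue p j c
  have hanti : ∀ {α β}, α ≤ β → β < κ.ord → v β ≤ v α := fun h hβ =>
    decisionValue_anti hcomplete hβ h
  -- the filter generated by the branch
  have hfilter : IsPFilter {y : L | ∃ α < κ.ord, v α ≤ y} := by
    refine IsPFilter.of_def ⟨v 0, 0, hlim.bot_lt, le_rfl⟩ ?_ ?_
    · rintro x ⟨α, hα, hx⟩ y ⟨β, hβ, hy⟩
      have hαβ := max_lt hα hβ
      exact ⟨v (max α β), ⟨_, hαβ, le_rfl⟩, (hanti (le_max_left _ _) hαβ).trans hx,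
        (hanti (le_max_right _ _) hαβ).trans hy⟩
    · rintro x y hxy ⟨α, hα, hx⟩
      exact ⟨α, hα, hx.trans hxy⟩
  have hmem : ∀ y, y ∈ hfilter.toPFilter ↔ ∃ α < κ.ord, v α ≤ y := fun y => Iff.rfl
  have hdisj : ∀ y ∈ hfilter.toPFilter, y ∉ I := by
    rintro y ⟨α, hα, hy⟩ hyI
    exact hcI α hα (I.lower hy hyI)
  refine ⟨hfilter.toPFilter, fun B hB hBP m hm => ?_, fun B hB l hl hlP => ?_, fun x hx => ?_,
    Set.disjoint_left.2 hdisj⟩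
  · choose! α hα hαv using hBP
    have hsup : ⨆ b : B, α b < κ.ord := Ordinal.iSup_lt_of_lt_cof
      (by rwa [hκ.isRegular.cof_ord]) fun b => hα b b.2
    refine ⟨_, hsup, hm.2 fun b hb => (hanti ?_ hsup).trans (hαv b hb)⟩
    exact le_ciSup (f := fun b : B => α b) Ordinal.bddAbove_of_small ⟨b, hb⟩
  · have hBne : B.Nonempty := by
      -- the join of the empty set is in every ideal
      rw [Set.nonempty_iff_ne_empty]
      rintro rfl
      obtain ⟨i, hi⟩ := I.nonempty
      exact hdisj l hlP (I.lower (hl.2 fun _ h => absurd h (Set.notMem_empty _)) hi)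
    obtain ⟨β, hβ, hβl⟩ := hlP
    -- `B` is treated at some step after the one at which its join is reached
    obtain ⟨α, hβα, hα, heα⟩ := he (⟨p₀, hp₀⟩, ⟨⟨B, hB⟩, hBne⟩) β hβ
    have hAB : A α = B := by simp only [A, heα]
    have hjl : j α = l := (hj α).unique (hAB ▸ hl)
    have hle : v α ⊓ p α ≤ j α := by
      rw [hjl]
      exact inf_le_left.trans ((hanti hβα hα).trans hβl)
    have hα' := hlim.succ_lt hα
    refine ⟨c α, hAB ▸ hcA α hα, succ α, hα', ?_⟩
    have hstep : v (succ α) = decisionStep p j α (v α) (c α) := decisionValue_succ hcomplete hα'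
    rw [hstep, decisionStep, if_pos hle]
    exact inf_le_right
  · obtain ⟨α, -, hα, heα⟩ := he (⟨x, hx⟩, ⟨⟨{p₀}, hsmall p₀⟩, Set.singleton_nonempty p₀⟩) 0
      hlim.bot_lt
    have hpα : p α = x := by simp only [p, heα]
    exact ⟨succ α, hlim.succ_lt hα,
      hpα ▸ decisionValue_le_of_lt hcomplete (hlim.succ_lt hα) (lt_succ α)⟩
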